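/- Let $n\ge 2$, let $\Omega\subset\mathbb{C}^n$ be open and let $K\subset\Omega$ be compact. For an open set $U\subset\mathbb{C}^n$ let $\mathcal{H}(U)$ be the $\mathbb{C}$-algebra of holomorphic functions $U\to\mathbb{C}$. The following statements are equivalent: (i) every $f\in\mathcal{H}(\Omega\setminus K)$ has an extension $\tilde f\in\mathcal{H}(\Omega)$; equivalently, every such $f$ has a unique extension $\tilde f\in\mathcal{H}(\Omega)$; (i') every locally constant function $g:\Omega\setminus K\to\mathbb{C}$ has an extension $\tilde g\in\mathcal{H}(\Omega)$; (ii) the restriction map $\rho:\mathcal{H}(\Omega)\to\mathcal{H}(\Omega\setminus K)$, $\rho(f)=f|_{\Omega\setminus K}$, is an isomorphism of $\mathbb{C}$-algebras; (iii) $\mathbb{C}^n\setminus K$ is connected. In this case, $f(\Omega)=f(\Omega\setminus K)$ for every $f\in\mathcal{H}(\Omega)$. Moreover, in this case, let $$C=\bigcup_{\omega}\big(\omega\cap K_\omega^{\mathrm u}\big),$$ where $\omega$ runs over the connected components of $\Omega$ and $K_\omega^{\mathrm u}$ denotes the unbounded connected component of $\mathbb{C}^n\setminus(K\cap\omega)$.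 Then for every $f\in\mathcal{H}(\Omega\setminus K)$ there is a unique $\tilde f\in\mathcal{H}(\Omega)$ with $\tilde f=f$ on $C\subset\Omega\setminus K$ (the Hartogs companion of $f$); the map $f\mapsto\tilde f$ is an isomorphism of $\mathbb{C}$-algebras inverse to $\rho$, and it preserves ranges: $\tilde f(\Omega)=f(\Omega\setminus K)$. -/

import Mathlib

/-- The algebra `H(U)` of holomorphic functions `U → ℂ` on a subset `U` (open, in all uses) of a
complex normed space: the functions on `U` which are complex (Fréchet) differentiable on `U`.
Differentiability is tested on any function on the whole space with the given values on `U`. -/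
def Holo {E : Type*} [NormedAddCommGroup E] [NormedSpace ℂ E] (U : Set E) :
    Subalgebra ℂ (U → ℂ) where
  carrier := {f | ∃ F : E → ℂ, DifferentiableOn ℂ F U ∧ ∀ z : U, F z = f z}
  mul_mem' := by
    rintro f g ⟨F, hF, hf⟩ ⟨G, hG, hg⟩
    exact ⟨fun z => F z * G z, hF.mul hG, fun z => by simp [hf, hg]⟩
  add_mem' := by
    rintro f g ⟨F, hF, hf⟩ ⟨G, hG, hg⟩
    exact ⟨fun z => F z + G z, hF.add hG, fun z => by simp [hf, hg]⟩
  algebraMap_mem' := fun c => ⟨fun _ => c, differentiableOn_const c, fun _ => rfl⟩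

/-- The restriction morphism `ρ : H(Ω) → H(Ω \ K)`, `ρ f = f|_{Ω \ K}`. -/
def holoRestrict {E : Type*} [NormedAddCommGroup E] [NormedSpace ℂ E] (Ω K : Set E) :
    Holo Ω →ₐ[ℂ] Holo (Ω \ K) where
  toFun f := ⟨fun z => f.1 ⟨z.1, z.2.1⟩, by
    obtain ⟨F, hF, hf⟩ := f.2
    exact ⟨F, hF.mono Set.sdiff_subset, fun z => hf ⟨z.1, z.2.1⟩⟩⟩
  map_one' := rfl
  map_mul' _ _ := rfl
  map_zero' := rfl
  map_add' _ _ := rfl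
  commutes' _ := rfl

/-- `Extends Ω K F g`: the function `F` on `Ω` is an extension of the function `g` on `Ω \ K`. -/
def Extends {E : Type*} (Ω K : Set E) (F : Ω → ℂ) (g : ↥(Ω \ K) → ℂ) : Prop :=
  ∀ z : ↥(Ω \ K), F ⟨z.1, z.2.1⟩ = g z

/-- The points of the complement of `S` whose connected component in that complement is unbounded.
For a compact `S` in `ℂⁿ`, `n ≥ 2`, this is *the* unbounded component of `ℂⁿ \ S`. -/
def unboundedComponent {E : Type*} [NormedAddCommGroup E] (S : Set E) : Set E :=
  {z | z ∈ Sᶜ ∧ ¬ Bornology.IsBounded (connectedComponentIn Sᶜ z)}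

/-- The coincidence set of `K ⊆ Ω`: the union, over the connected components `ω` of `Ω`, of the
intersection of `ω` with the unbounded component of `ℂⁿ \ (K ∩ ω)`. -/
def coincidenceSet {E : Type*} [NormedAddCommGroup E] (Ω K : Set E) : Set E :=
  {z | ∃ x ∈ Ω, z ∈ connectedComponentIn Ω x ∩
    unboundedComponent (K ∩ connectedComponentIn Ω x)}

/-- `F ∈ H(Ω)` is a Hartogs companion of `f ∈ H(Ω \ K)`: both functions agree on the coincidence
set (which is a subset of `Ω \ K`). -/
def IsHartogsCompanion {E : Type*} [NormedAddCommGroup E] [NormedSpace ℂ E] (Ω K : Set E)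
    (f : Holo (Ω \ K)) (F : Holo Ω) : Prop :=
  ∀ z : ↥(Ω \ K), z.1 ∈ coincidenceSet Ω K → F.1 ⟨z.1, z.2.1⟩ = f.1 z

/-!
Everything rests on the Hartogs extension theorem `exists_holomorphic_extension`, proved with the
`∂̄`-equation. Let `χ` be a cutoff function with compact support in `Ω`, equal to `1` near `K`. For
`f` holomorphic on `Ω \ K`, the data `-f ∂̄χ` are `∂̄`-closed, of class `C¹` and compactly supported.
A primitive `u` is the Cauchy transform along a single complex direction `e`: it can be
differentiated under the integral sign, the closedness of the data moves every derivative to the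
direction `e`, and the one-variable Cauchy–Pompeiu formula applies (`exists_dbar_primitive`). In
dimension at least two it vanishes at points far away in a direction transversal to `e`. Then
`F = (1 - χ) f - u` is holomorphic on `Ω`. The difference `F - f = -χ f - u` makes sense and is
holomorphic on all of `Kᶜ`, and it vanishes on a nonempty open set, so that it is zero as soon as
`Kᶜ` is connected. Hence no separate topological argument on the components of `Ω \ K` is needed.

A holomorphic function on `Ω` is determined by its values on the coincidence set
(`eqOn_zero_of_eqOn_zero_coincidenceSet`): an unbounded component of the complement of `K ∩ ω` that
missed the component `ω` would be open and closed in the whole space. This gives all uniqueness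
statements. Conversely, a separation of `Kᶜ` restricts to a locally constant function on `Ω \ K`,
and an extension of it would separate the whole space
(`isPreconnected_compl_of_locallyConstant_extends`). Ranges are preserved because `1 / (F - c)`
extends together with `F` (`range_eq_range_holoRestrict`).
-/

section HolomorphicExtension

open Set Filter Topology MeasureTheory Metric Complex

variable {E : Type*} [NormedAddCommGroup E] [NormedSpace ℂ E]

/-! ### The Cauchy–Riemann operator -/

/-- The Cauchy–Riemann operator `∂̄` in the direction `v`, without the usual factor `1/2`:
`∂̄_v g = D_v g + i D_{iv} g`. It is conjugate linear in `v`. -/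
noncomputable def dbar (v : E) (g : E → ℂ) (z : E) : ℂ :=
  fderiv ℝ g z v + I * fderiv ℝ g z (I • v)

theorem complex_smul_eq_re_add_im (c : ℂ) (v : E) : c • v = c.re • v + c.im • I • v := by
  conv_lhs => rw [← re_add_im c]
  rw [add_smul, mul_smul, coe_smul, coe_smul]

theorem dbar_smul (c : ℂ) (v : E) (g : E → ℂ) (z : E) :
    dbar (c • v) g z = (starRingEnd ℂ) c * dbar v g z := by
  have h1 : c • v = c.re • v + c.im • I • v := complex_smul_eq_re_add_im c v
  have h2 : I • c • v = (-c.im) • v + c.re • I • v := by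
    rw [smul_smul, complex_smul_eq_re_add_im]; simp
  have hc : (starRingEnd ℂ) c = c.re - c.im * I := by
    apply Complex.ext <;> simp
  unfold dbar
  rw [h2, h1, hc]
  simp only [map_add, map_smul, real_smul, ofReal_neg]
  linear_combination (fderiv ℝ g z (I • v) * c.im) * I_mul_I

theorem dbar_congr {f g : E → ℂ} {z : E} (h : f =ᶠ[𝓝 z] g) (v : E) :
    dbar v f z = dbar v g z := by
  simp only [dbar, h.fderiv_eq]

theorem dbar_eventuallyEq {f g : E → ℂ} {z : E} (h : f =ᶠ[𝓝 z] g) (v : E) :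
    dbar v f =ᶠ[𝓝 z] dbar v g :=
  h.eventuallyEq_nhds.mono fun _ hw => dbar_congr hw v

@[simp]
theorem dbar_const (v : E) (c : ℂ) (z : E) : dbar v (fun _ => c) z = 0 := by
  simp [dbar]

theorem dbar_neg (v : E) (f : E → ℂ) (z : E) : dbar v (fun w => -f w) z = -dbar v f z := by
  simp only [dbar, fderiv_fun_neg, _root_.neg_apply]
  ring

theorem dbar_sub {f g : E → ℂ} {z : E} (hf : DifferentiableAt ℝ f z)
    (hg : DifferentiableAt ℝ g z) (v : E) :
    dbar v (fun w => f w - g w) z = dbar v f z - dbar v g z := by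
  simp only [dbar, fderiv_fun_sub hf hg, _root_.sub_apply]
  ring

theorem dbar_mul {f g : E → ℂ} {z : E} (hf : DifferentiableAt ℝ f z)
    (hg : DifferentiableAt ℝ g z) (v : E) :
    dbar v (fun w => f w * g w) z = f z * dbar v g z + g z * dbar v f z := by
  simp only [dbar, fderiv_fun_mul hf hg, _root_.add_apply,
    _root_.smul_apply, smul_eq_mul]
  ring

theorem dbar_eq_zero {f : E → ℂ} {z : E} (hf : DifferentiableAt ℂ f z) (v : E) :
    dbar v f z = 0 := by
  simp only [dbar, hf.fderiv_restrictScalars ℝ, ContinuousLinearMap.coe_restrictScalars',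
    map_smul, smul_eq_mul]
  linear_combination (fderiv ℂ f z v) * I_mul_I

theorem differentiableAt_complex_of_dbar_eq_zero {f : E → ℂ} {z : E}
    (hf : DifferentiableAt ℝ f z) (h : ∀ v, dbar v f z = 0) : DifferentiableAt ℂ f z := by
  have hI : ∀ v, fderiv ℝ f z (I • v) = I * fderiv ℝ f z v := fun v => by
    have := h v
    unfold dbar at this
    linear_combination -I * this + fderiv ℝ f z (I • v) * I_mul_I
  refine (differentiableAt_iff_restrictScalars ℝ hf).2
    ⟨{ toFun := fderiv ℝ f z, map_add' := map_add _, map_smul' := fun c v => ?_,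
       cont := (fderiv ℝ f z).continuous }, rfl⟩
  rw [complex_smul_eq_re_add_im c v]
  simp only [map_add, map_smul, hI, real_smul, RingHom.id_apply, smul_eq_mul]
  conv_rhs => rw [← re_add_im c]
  ring

theorem ContDiff.dbar {f : E → ℂ} {m n : WithTop ℕ∞} (hf : ContDiff ℝ n f) (hmn : m + 1 ≤ n)
    (v : E) : ContDiff ℝ m (dbar v f) := by
  have h := hf.fderiv_right hmn
  exact (h.clm_apply contDiff_const).add (contDiff_const.mul (h.clm_apply contDiff_const))

theorem dbar_comm {f : E → ℂ} (hf : ContDiff ℝ 2 f) (v w : E) (z : E) :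
    dbar w (dbar v f) z = dbar v (dbar w f) z := by
  have hd : HasFDerivAt (fderiv ℝ f) (fderiv ℝ (fderiv ℝ f) z) z :=
    ((hf.fderiv_right (m := 1) (by norm_num [one_add_one_eq_two])).differentiable
      (by simp) z).hasFDerivAt
  have key : ∀ v : E, HasFDerivAt (dbar v f)
      ((fderiv ℝ (fderiv ℝ f) z).flip v + I • (fderiv ℝ (fderiv ℝ f) z).flip (I • v)) z := by
    intro v
    have h1 : ∀ v : E, HasFDerivAt (fun z => fderiv ℝ f z v)
        ((fderiv ℝ (fderiv ℝ f) z).flip v) z := fun v => by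
      simpa using hd.clm_apply (hasFDerivAt_const v z)
    exact (h1 v).add ((h1 (I • v)).const_mul I)
  have hs := hf.contDiffAt.isSymmSndFDerivAt (x := z) (by simp)
  rw [dbar, dbar, (key v).fderiv, (key w).fderiv]
  simp only [_root_.add_apply, ContinuousLinearMap.flip_apply,
    _root_.smul_apply, smul_eq_mul]
  rw [hs w v, hs w (I • v), hs (I • w) v, hs (I • w) (I • v)]
  ring

/-! ### The Cauchy transform along a complex direction -/

/-- The Cauchy transform of `ψ` along the complex direction `e`, over the disc of radius `R`: up to
normalization, the integral over `‖ζ‖ ≤ R` of `ψ (z - ζ e) / ζ`. It is written in polar coordinates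
`ζ = r exp (iθ)`, where the Jacobian `r` cancels the singularity of the kernel. -/
noncomputable def cauchyTransform (e : E) (R : ℝ) (ψ : E → ℂ) (z : E) : ℂ :=
  (2 * (Real.pi : ℂ))⁻¹ * ∫ p in Ioc 0 R ×ˢ Ioc (-Real.pi) Real.pi,
    exp (-(p.2 * I)) * ψ (z - (p.1 * exp (p.2 * I)) • e)

theorem integrableOn_polar_of_continuous {R : ℝ} {F : Type*} [NormedAddCommGroup F] {f : ℝ × ℝ → F}
    (hf : Continuous f) : IntegrableOn f (Ioc 0 R ×ˢ Ioc (-Real.pi) Real.pi) :=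
  (hf.continuousOn.integrableOn_compact (isCompact_Icc.prod isCompact_Icc)).mono_set
    (prod_mono Ioc_subset_Icc_self Ioc_subset_Icc_self)

theorem hasFDerivAt_cauchyTransform (e : E) (R : ℝ) {ψ : E → ℂ} (hψ : ContDiff ℝ 1 ψ)
    (hc : HasCompactSupport ψ) (z : E) :
    HasFDerivAt (cauchyTransform e R ψ)
      ((2 * (Real.pi : ℂ))⁻¹ • ∫ p in Ioc 0 R ×ˢ Ioc (-Real.pi) Real.pi,
        exp (-(p.2 * I)) • fderiv ℝ ψ (z - (p.1 * exp (p.2 * I)) • e)) z := by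
  have hψ' := hψ.continuous_fderiv one_ne_zero
  obtain ⟨C, hC⟩ := hψ'.bounded_above_of_compact_support (hc.fderiv (𝕜 := ℝ))
  refine HasFDerivAt.const_mul (𝕜 := ℝ) (𝔸 := ℂ) ?_ _
  refine hasFDerivAt_integral_of_dominated_of_fderiv_le (s := univ) (bound := fun _ => C)
    (F' := fun (z : E) (p : ℝ × ℝ) => exp (-(p.2 * I)) • fderiv ℝ ψ (z - (p.1 * exp (p.2 * I)) • e))
    univ_mem ?_ ?_ ?_ ?_ ?_ ?_
  · refine Eventually.of_forall fun x => ?_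
    have : Continuous fun p : ℝ × ℝ =>
        exp (-(p.2 * I)) * ψ (x - (p.1 * exp (p.2 * I)) • e) := by
      have := hψ.continuous
      fun_prop
    exact (integrableOn_polar_of_continuous this).aestronglyMeasurable
  · have : Continuous fun p : ℝ × ℝ =>
        exp (-(p.2 * I)) * ψ (z - (p.1 * exp (p.2 * I)) • e) := by
      have := hψ.continuous
      fun_prop
    exact integrableOn_polar_of_continuous this
  · have : Continuous fun p : ℝ × ℝ =>
        exp (-(p.2 * I)) • fderiv ℝ ψ (z - (p.1 * exp (p.2 * I)) • e) := by
      fun_prop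
    exact (integrableOn_polar_of_continuous this).aestronglyMeasurable
  · refine Eventually.of_forall fun p x _ => ?_
    rw [norm_smul, ← neg_mul, ← ofReal_neg, norm_exp_ofReal_mul_I, one_mul]
    exact hC _
  · exact integrableOn_polar_of_continuous continuous_const
  · refine Eventually.of_forall fun p x _ => ?_
    refine HasFDerivAt.const_mul (𝔸 := ℂ) ?_ _
    have h := (hψ.differentiable one_ne_zero (x - (p.1 * exp (p.2 * I)) • e)).hasFDerivAt
    have h' := h.comp x ((hasFDerivAt_id x).sub_const ((p.1 * exp (p.2 * I)) • e))
    rwa [ContinuousLinearMap.comp_id] at h'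

theorem dbar_cauchyTransform (e : E) (R : ℝ) {ψ : E → ℂ} (hψ : ContDiff ℝ 1 ψ)
    (hc : HasCompactSupport ψ) (v z : E) :
    dbar v (cauchyTransform e R ψ) z = cauchyTransform e R (dbar v ψ) z := by
  have hψ' := hψ.continuous_fderiv one_ne_zero
  have hcont : Continuous fun p : ℝ × ℝ =>
      exp (-(p.2 * I)) • fderiv ℝ ψ (z - (p.1 * exp (p.2 * I)) • e) := by
    fun_prop
  have hint := integrableOn_polar_of_continuous (R := R) hcont
  have hi := fun v : E => integrableOn_polar_of_continuous (R := R) (hcont.clm_apply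
    (continuous_const (y := v)))
  rw [dbar, (hasFDerivAt_cauchyTransform e R hψ hc z).fderiv, cauchyTransform]
  simp only [_root_.smul_apply, smul_eq_mul]
  rw [ContinuousLinearMap.integral_apply hint, ContinuousLinearMap.integral_apply hint,
    mul_left_comm, ← mul_add, ← integral_const_mul, ← integral_add (hi v) ((hi _).const_mul I)]
  congr 2
  funext p
  simp only [dbar, _root_.smul_apply, smul_eq_mul]
  ring

/-- The Cauchy–Pompeiu formula for a function vanishing on the circle of radius `R` around `z`.
In polar coordinates the integrand is `-∂_r H - (i / r) ∂_θ H` with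
`H (r, θ) = G (z - r exp (iθ) e)`; the radial part integrates to the value at the centre and the
angular part to zero. -/
theorem cauchyTransform_dbar (e : E) {R : ℝ} (hR : 0 ≤ R) {G : E → ℂ} (hG : ContDiff ℝ 1 G) (z : E)
    (h0 : ∀ ζ : ℂ, ‖ζ‖ = R → G (z - ζ • e) = 0) :
    cauchyTransform e R (dbar e G) z = G z := by
  have hG' := hG.continuous_fderiv one_ne_zero
  have hGd := fun z => (hG.differentiable one_ne_zero z).hasFDerivAt
  set A : ℝ × ℝ → ℂ := fun p =>
    fderiv ℝ G (z - (p.1 * exp (p.2 * I)) • e) (exp (p.2 * I) • e) with hA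
  set B : ℝ × ℝ → ℂ := fun p =>
    I * fderiv ℝ G (z - (p.1 * exp (p.2 * I)) • e) (I • exp (p.2 * I) • e) with hB
  have hAc : Continuous A := by fun_prop
  have hBc : Continuous B := by fun_prop
  have hpi : -Real.pi ≤ Real.pi := by linarith [Real.pi_pos]
  have hAB : ∀ p : ℝ × ℝ, exp (-(p.2 * I)) * dbar e G (z - (p.1 * exp (p.2 * I)) • e)
      = A p + B p := fun p => by
    have : exp (-(p.2 * I)) = (starRingEnd ℂ) (exp (p.2 * I)) := by
      rw [← exp_conj]; simp
    rw [this, ← dbar_smul]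
    rfl
  have hBint : ∫ p in Ioc 0 R ×ˢ Ioc (-Real.pi) Real.pi, B p = 0 := by
    rw [Measure.volume_eq_prod, setIntegral_prod _ (integrableOn_polar_of_continuous hBc)]
    refine (setIntegral_congr_fun measurableSet_Ioc fun r hr => ?_).trans (integral_zero' _ _)
    have hd : ∀ θ : ℝ, HasDerivAt (fun θ : ℝ => G (z - (r * exp (θ * I)) • e))
        (fderiv ℝ G (z - (r * exp (θ * I)) • e) (-((r * (exp (θ * I) * I)) • e))) θ := by
      intro θ
      refine (hGd _).comp_hasDerivAt θ ?_
      have h1 : HasDerivAt (fun θ : ℝ => exp (θ * I)) (exp (θ * I) * I) θ := by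
        simpa using ((hasDerivAt_id θ).ofReal_comp.mul_const I).cexp
      exact ((h1.const_mul (r : ℂ)).smul_const e).const_sub z
    have hint : ∫ θ in (-Real.pi)..Real.pi,
        fderiv ℝ G (z - (r * exp (θ * I)) • e) (-((r * (exp (θ * I) * I)) • e)) = 0 := by
      rw [intervalIntegral.integral_eq_sub_of_hasDerivAt (fun θ _ => hd θ)
        (Continuous.intervalIntegrable (by fun_prop) _ _)]
      simp [exp_neg]
    have hr0 : (r : ℂ) ≠ 0 := by exact_mod_cast hr.1.ne'
    have hBeq : ∀ θ : ℝ, B (r, θ) = -(I / r) *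
        fderiv ℝ G (z - (r * exp (θ * I)) • e) (-((r * (exp (θ * I) * I)) • e)) := by
      intro θ
      have : (r * (exp (θ * I) * I)) • e = r • I • exp (θ * I) • e := by
        rw [← coe_smul, smul_smul, smul_smul]; congr 1; ring
      simp only [hB, this, map_neg, map_smul, real_smul]
      field_simp
    simp only [hBeq]
    rw [← intervalIntegral.integral_of_le hpi, intervalIntegral.integral_const_mul, hint, mul_zero]
    rfl
  have hAint : ∫ p in Ioc 0 R ×ˢ Ioc (-Real.pi) Real.pi, A p = 2 * Real.pi * G z := by
    rw [Measure.volume_eq_prod, ← setIntegral_prod_swap, setIntegral_prod]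
    · have hin : ∀ θ : ℝ, ∫ r in Ioc 0 R, A (r, θ) = G z := by
        intro θ
        have hd : ∀ r : ℝ,
            HasDerivAt (fun r : ℝ => G (z - (r * exp (θ * I)) • e)) (-A (r, θ)) r := by
          intro r
          have h1 : HasDerivAt (fun r : ℝ => (r : ℂ)) 1 r := (hasDerivAt_id r).ofReal_comp
          have h2 := ((h1.mul_const (exp (θ * I))).smul_const e).const_sub z
          rw [one_mul] at h2
          have h3 := (hGd _).comp_hasDerivAt r h2
          rwa [map_neg] at h3
        have h1 := intervalIntegral.integral_eq_sub_of_hasDerivAt (a := 0) (b := R)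
          (fun r _ => hd r) (Continuous.intervalIntegrable (by fun_prop) _ _)
        rw [intervalIntegral.integral_neg, h0 _ (by simp [norm_exp_ofReal_mul_I, abs_of_nonneg hR]),
          intervalIntegral.integral_of_le hR] at h1
        simpa using h1
      simp only [Prod.swap_prod_mk, hin]
      rw [← intervalIntegral.integral_of_le hpi]
      rw [intervalIntegral.integral_const, real_smul]
      push_cast
      ring
    · refine IntegrableOn.mono_set ?_ (prod_mono Ioc_subset_Icc_self Ioc_subset_Icc_self)
      exact (hAc.comp continuous_swap).continuousOn.integrableOn_compact
        (isCompact_Icc.prod isCompact_Icc)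
  rw [cauchyTransform]
  simp only [hAB]
  rw [integral_add (integrableOn_polar_of_continuous hAc) (integrableOn_polar_of_continuous hBc),
    hBint, hAint]
  have : (Real.pi : ℂ) ≠ 0 := by exact_mod_cast Real.pi_ne_zero
  rw [add_zero]
  field_simp

theorem cauchyTransform_congr_radius {e : E} {R R' : ℝ} (hRR' : R ≤ R') {ψ : E → ℂ} {z : E}
    (h0 : ∀ ζ : ℂ, R ≤ ‖ζ‖ → ψ (z - ζ • e) = 0) :
    cauchyTransform e R' ψ z = cauchyTransform e R ψ z := by
  rw [cauchyTransform, cauchyTransform]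
  congr 1
  refine setIntegral_eq_of_subset_of_forall_sdiff_eq_zero
    (measurableSet_Ioc.prod measurableSet_Ioc) (prod_mono (Ioc_subset_Ioc_right hRR') subset_rfl) ?_
  rintro p ⟨hp, hp'⟩
  have h1 : R < p.1 := by
    by_contra h
    exact hp' ⟨⟨hp.1.1, not_lt.1 h⟩, hp.2⟩
  rw [h0, mul_zero]
  rw [norm_mul, norm_exp_ofReal_mul_I, mul_one, norm_real, Real.norm_eq_abs]
  exact h1.le.trans (le_abs_self _)

/-- Compactly supported `∂̄`-closed data admit a primitive `u`, which vanishes at every point whose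
complex line in the direction `e` misses the support of the data. -/
theorem exists_dbar_primitive [FiniteDimensional ℂ E] {ψ : E → E → ℂ} {M : ℝ} (hM : 0 < M)
    (hψ : ∀ v, ContDiff ℝ 1 (ψ v)) (hsupp : ∀ v z, M ≤ ‖z‖ → ψ v z = 0)
    (hclosed : ∀ v w z, dbar w (ψ v) z = dbar v (ψ w) z) {e : E} (he : ‖e‖ = 1) :
    ∃ u : E → ℂ, Differentiable ℝ u ∧ (∀ v z, dbar v u z = ψ v z) ∧
      ∀ z, (∀ ζ : ℂ, ψ e (z - ζ • e) = 0) → u z = 0 := by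
  have : ProperSpace E := FiniteDimensional.proper ℂ E
  have hc : ∀ v, HasCompactSupport (ψ v) := fun v =>
    HasCompactSupport.intro (isCompact_closedBall (0 : E) M) fun z hz => hsupp v z (by
      simpa using (not_le.1 (fun h => hz (mem_closedBall_zero_iff.2 h))).le)
  have hfar : ∀ (v z : E) (R : ℝ), M + ‖z‖ ≤ R → ∀ ζ : ℂ, R ≤ ‖ζ‖ → ψ v (z - ζ • e) = 0 := by
    intro v z R hR ζ hζ
    apply hsupp
    have := norm_sub_norm_le (ζ • e) z
    rw [norm_smul, he, mul_one, norm_sub_rev] at this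
    linarith
  set u : E → ℂ := fun z => cauchyTransform e (M + ‖z‖) (ψ e) z with hu
  -- Near each point the radius can be kept fixed.
  have hloc : ∀ z, u =ᶠ[𝓝 z] cauchyTransform e (M + (‖z‖ + 1)) (ψ e) := fun z => by
    have : ∀ᶠ w in 𝓝 z, ‖w‖ < ‖z‖ + 1 := continuous_norm.continuousAt.eventually_lt_const (by simp)
    filter_upwards [this] with w hw
    exact (cauchyTransform_congr_radius (by linarith) (hfar e w _ le_rfl)).symm
  refine ⟨u, fun z => ?_, fun v z => ?_, fun z hz => ?_⟩
  · exact (hasFDerivAt_cauchyTransform e _ (hψ e) (hc e) z).differentiableAt.congr_of_eventuallyEq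
      (hloc z)
  · rw [dbar_congr (hloc z), dbar_cauchyTransform e _ (hψ e) (hc e)]
    have : dbar v (ψ e) = dbar e (ψ v) := funext fun z => hclosed e v z
    rw [this]
    exact cauchyTransform_dbar e (by positivity) (hψ v) z
      fun ζ hζ => hfar v z _ (by linarith) ζ hζ.ge
  · simp [hu, cauchyTransform, hz]

/-! ### Holomorphic functions of several variables -/

/-- A holomorphic function is continuously differentiable: by the one-variable Cauchy estimate on
complex lines, the derivative depends continuously on the translates of the function. -/
theorem continuousAt_fderiv_of_holomorphic [FiniteDimensional ℂ E] {f : E → ℂ} {U : Set E}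
    (hU : IsOpen U) (hf : DifferentiableOn ℂ f U) {z : E} (hz : z ∈ U) :
    ContinuousAt (fderiv ℂ f) z := by
  have : ProperSpace E := FiniteDimensional.proper ℂ E
  obtain ⟨r, hr, hrU⟩ := Metric.isOpen_iff.1 hU z hz
  have hr3 : 0 < r / 3 := by positivity
  have hsub : closedBall z (2 * (r / 3)) ⊆ U :=
    (closedBall_subset_ball (by linarith)).trans hrU
  have huc : UniformContinuousOn f (closedBall z (2 * (r / 3))) :=
    (isCompact_closedBall _ _).uniformContinuousOn_of_continuous (hf.continuousOn.mono hsub)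
  rw [Metric.continuousAt_iff]
  intro ε hε
  obtain ⟨δ, hδ, hδf⟩ := Metric.uniformContinuousOn_iff.1 huc (ε / 2 * (r / 3)) (by positivity)
  refine ⟨min δ (r / 3), lt_min hδ hr3, fun {w} hw => ?_⟩
  rw [dist_eq_norm]
  refine (ContinuousLinearMap.opNorm_le_of_unit_norm (𝕜 := ℂ) (half_pos hε).le
    fun v hv => ?_).trans_lt (half_lt_self hε)
  have hline : ∀ a : E, dist a z < r / 3 → ∀ t : ℂ, ‖t‖ ≤ r / 3 →
      a + t • v ∈ closedBall z (2 * (r / 3)) := by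
    intro a ha t ht
    rw [mem_closedBall, dist_eq_norm, add_sub_right_comm]
    refine (norm_add_le _ _).trans ?_
    rw [norm_smul, hv, mul_one, ← dist_eq_norm]
    linarith
  have hda : ∀ a : E, dist a z < r / 3 → ∀ t : ℂ, ‖t‖ ≤ r / 3 →
      HasDerivAt (fun t : ℂ => f (a + t • v)) (fderiv ℂ f (a + t • v) v) t := by
    intro a ha t ht
    have h1 := (hf.differentiableAt (hU.mem_nhds (hsub (hline a ha t ht)))).hasFDerivAt
    have h2 : HasDerivAt (fun t : ℂ => a + t • v) v t := by
      simpa using ((hasDerivAt_id t).smul_const v).const_add a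
    exact h1.comp_hasDerivAt t h2
  have hwz : dist w z < r / 3 := hw.trans_le (min_le_right _ _)
  have hzz : dist z z < r / 3 := by simpa using hr3
  have hder : ∀ t : ℂ, ‖t‖ ≤ r / 3 → HasDerivAt (fun t : ℂ => f (w + t • v) - f (z + t • v))
      (fderiv ℂ f (w + t • v) v - fderiv ℂ f (z + t • v) v) t :=
    fun t ht => (hda w hwz t ht).sub (hda z hzz t ht)
  have hcl : closure (ball (0 : ℂ) (r / 3)) = closedBall 0 (r / 3) := closure_ball _ hr3.ne'
  have hD : DiffContOnCl ℂ (fun t : ℂ => f (w + t • v) - f (z + t • v)) (ball 0 (r / 3)) := by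
    apply DifferentiableOn.diffContOnCl
    rw [hcl]
    intro t ht
    exact (hder t (by simpa using ht)).differentiableAt.differentiableWithinAt
  have key := norm_deriv_le_of_forall_mem_sphere_norm_le (C := ε / 2 * (r / 3)) hr3 hD
    fun t ht => by
      have ht' : ‖t‖ ≤ r / 3 := by simpa using (mem_sphere_zero_iff_norm.1 ht).le
      rw [← dist_eq_norm]
      refine (hδf _ (hline w hwz t ht') _ (hline z hzz t ht') ?_).le
      rw [dist_add_right]
      exact hw.trans_le (min_le_left _ _)
  rw [(hder 0 (by simpa using hr3.le)).deriv, mul_div_cancel_right₀ _ hr3.ne'] at key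
  simpa using key

theorem contDiffAt_one_of_holomorphic [FiniteDimensional ℂ E] {f : E → ℂ} {U : Set E}
    (hU : IsOpen U) (hf : DifferentiableOn ℂ f U) {z : E} (hz : z ∈ U) :
    ContDiffAt ℂ 1 f z := by
  rw [contDiffAt_one_iff]
  refine ⟨fderiv ℂ f, U, hU.mem_nhds hz,
    fun w hw => (continuousAt_fderiv_of_holomorphic hU hf hw).continuousWithinAt,
    fun w hw => (hf.differentiableAt (hU.mem_nhds hw)).hasFDerivAt⟩

/-- The identity theorem: a holomorphic function on a ball that vanishes near one point vanishes on
the ball. It is the one-variable identity theorem on the complex lines through that point. -/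
theorem eqOn_zero_ball_of_eventuallyEq_zero {f : E → ℂ} {c a : E} {r : ℝ}
    (hf : DifferentiableOn ℂ f (ball c r)) (ha : a ∈ ball c r) (h0 : f =ᶠ[𝓝 a] 0) :
    ∀ w ∈ ball c r, f w = 0 := by
  intro w hw
  set L : ℂ → E := fun t => a + t • (w - a) with hL
  have hLd : Differentiable ℂ L := by fun_prop
  have hV : IsOpen (L ⁻¹' ball c r) := isOpen_ball.preimage hLd.continuous
  have hconv : Convex ℝ (L ⁻¹' ball c r) := by
    intro s hs t ht x y hx hy hxy
    have : L (x • s + y • t) = x • L s + y • L t := by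
      simp only [hL, ← coe_smul, smul_eq_mul]
      have : (x : ℂ) + y = 1 := by exact_mod_cast hxy
      rw [smul_add, smul_add, smul_smul, smul_smul, add_add_add_comm, ← add_smul, ← add_smul, this,
        one_smul]
    rw [mem_preimage, this]
    exact convex_ball c r hs ht hx hy hxy
  have hd : DifferentiableOn ℂ (f ∘ L) (L ⁻¹' ball c r) :=
    hf.comp hLd.differentiableOn (mapsTo_preimage _ _)
  have hL0 : L 0 = a := by simp [hL]
  have hL1 : L 1 = w := by simp [hL]
  have hev : f ∘ L =ᶠ[𝓝 0] 0 := by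
    have : Tendsto L (𝓝 0) (𝓝 a) := by
      simpa [hL0] using hLd.continuous.tendsto 0
    exact this.eventually h0
  have := (hd.analyticOnNhd hV).eqOn_zero_of_preconnected_of_eventuallyEq_zero
    hconv.isPreconnected (show (0 : ℂ) ∈ L ⁻¹' ball c r by rwa [mem_preimage, hL0]) hev
    (show (1 : ℂ) ∈ L ⁻¹' ball c r by rwa [mem_preimage, hL1])
  simpa [hL1] using this

theorem eqOn_zero_of_isPreconnected_of_eventuallyEq_zero {f : E → ℂ} {U : Set E} (hU : IsOpen U)
    (hconn : IsPreconnected U) (hf : DifferentiableOn ℂ f U) {a : E} (ha : a ∈ U)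
    (h0 : f =ᶠ[𝓝 a] 0) : ∀ z ∈ U, f z = 0 := by
  have hsub : U ⊆ {z | f =ᶠ[𝓝 z] 0} := by
    refine hconn.subset_of_closure_inter_subset ?_ ⟨a, ha, h0⟩ ?_
    · exact isOpen_setOfPred_eventually_nhds
    · rintro z ⟨hz, hzU⟩
      obtain ⟨r, hr, hrU⟩ := Metric.isOpen_iff.1 hU z hzU
      obtain ⟨b, hb, hbz⟩ := Metric.mem_closure_iff.1 hz r hr
      have := eqOn_zero_ball_of_eventuallyEq_zero (hf.mono hrU)
        (show b ∈ ball z r by rwa [mem_ball, dist_comm]) hb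
      exact eventually_of_mem (ball_mem_nhds z hr) this
  exact fun z hz => (hsub hz).self_of_nhds

/-! ### Extension across a compact set with connected complement -/

theorem exists_contDiff_cutoff [FiniteDimensional ℂ E] {K Ω : Set E} (hK : IsCompact K)
    (hΩ : IsOpen Ω) (hKΩ : K ⊆ Ω) :
    ∃ χ : E → ℂ, ContDiff ℝ 2 χ ∧ HasCompactSupport χ ∧ tsupport χ ⊆ Ω ∧
      ∀ z ∈ K, χ =ᶠ[𝓝 z] fun _ => 1 := by
  have : FiniteDimensional ℝ E := FiniteDimensional.complexToReal E
  have : ProperSpace E := FiniteDimensional.proper ℂ E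
  obtain ⟨L, hL, hKL, hLΩ⟩ := exists_compact_between hK hΩ hKΩ
  obtain ⟨φ, h1, h0, -⟩ := exists_contMDiffMap_one_nhds_of_subset_interior (n := 2)
    (modelWithCornersSelf ℝ E) hK.isClosed hKL
  have hφ : ContDiff ℝ 2 φ := contMDiff_iff_contDiff.1 φ.contMDiff
  have hsupp : tsupport (fun z => (φ z : ℂ)) ⊆ L :=
    closure_minimal (fun z hz => by
      by_contra h
      exact hz (by simp [h0 z h])) hL.isClosed
  refine ⟨fun z => φ z, ofRealCLM.contDiff.comp hφ,
    hL.of_isClosed_subset (isClosed_tsupport _) hsupp,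
    hsupp.trans hLΩ, fun z hz => ?_⟩
  have := (eventually_nhdsSet_iff_forall.1 h1) z hz
  filter_upwards [this] with w hw
  simp [hw]

/-- The Hartogs extension theorem. For a cutoff function `χ` equal to `1` near `K`, correct
`(1 - χ) f` by a solution `u` of `∂̄u = -f ∂̄χ` which vanishes on a nonempty open set of points
lying far away in a direction transversal to `e`. The correction term `h = -χ f - u` is holomorphic
on the whole complement of `K`, not just on `Ω \ K`, so the identity theorem on the connected set
`Kᶜ` shows that it vanishes. -/
theorem exists_holomorphic_extension [FiniteDimensional ℂ E] (hE : 1 < Module.finrank ℂ E)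
    {Ω K : Set E} (hΩ : IsOpen Ω) (hK : IsCompact K) (hKΩ : K ⊆ Ω) (hconn : IsPreconnected Kᶜ)
    {f : E → ℂ} (hf : DifferentiableOn ℂ f (Ω \ K)) :
    ∃ F : E → ℂ, DifferentiableOn ℂ F Ω ∧ ∀ z ∈ Ω \ K, F z = f z := by
  have : ProperSpace E := FiniteDimensional.proper ℂ E
  have : Nontrivial E := Module.nontrivial_of_finrank_pos (R := ℂ) (by omega)
  have hΩK : IsOpen (Ω \ K) := hΩ.sdiff hK.isClosed
  obtain ⟨χ, hχ, hχc, hχΩ, hχK⟩ := exists_contDiff_cutoff hK hΩ hKΩ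
  obtain ⟨x₀, hx₀⟩ := exists_ne (0 : E)
  obtain ⟨l, -, hlx⟩ := exists_dual_vector ℂ x₀ (norm_ne_zero_iff.2 hx₀)
  obtain ⟨e, he, hle⟩ : ∃ e : E, ‖e‖ = 1 ∧ l e = 0 := by
    have : LinearMap.ker (l : E →ₗ[ℂ] ℂ) ≠ ⊥ :=
      LinearMap.ker_ne_bot_of_finrank_lt (by simpa using hE)
    obtain ⟨e, he, he0⟩ := Submodule.exists_mem_ne_zero_of_ne_bot this
    refine ⟨(‖e‖⁻¹ : ℂ) • e, ?_, ?_⟩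
    · rw [norm_smul]
      simp [he0]
    · have : l e = 0 := he
      rw [map_smul, this, smul_zero]
  obtain ⟨M, hM, hχM⟩ : ∃ M : ℝ, 0 < M ∧ tsupport χ ⊆ ball 0 M := by
    obtain ⟨M, hM⟩ := hχc.isCompact.isBounded.subset_ball 0
    exact ⟨max M 1, by positivity, hM.trans (ball_subset_ball (le_max_left _ _))⟩
  have hχ0 : ∀ z ∉ tsupport χ, χ =ᶠ[𝓝 z] fun _ => 0 := fun z hz =>
    notMem_tsupport_iff_eventuallyEq.1 hz
  have hKχ : K ⊆ tsupport χ := fun z hz => subset_tsupport _ (by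
    rw [Function.mem_support, (hχK z hz).self_of_nhds]; exact one_ne_zero)
  -- Off `Ω \ K` the cutoff is locally constant, so the values of `f` there do not matter.
  have hcases : ∀ z, z ∈ Ω \ K ∨ ∃ c, χ =ᶠ[𝓝 z] fun _ => c := fun z => by
    by_cases hzK : z ∈ K
    · exact Or.inr ⟨1, hχK z hzK⟩
    · by_cases hzΩ : z ∈ Ω
      · exact Or.inl ⟨hzΩ, hzK⟩
      · exact Or.inr ⟨0, hχ0 z fun h => hzΩ (hχΩ h)⟩
  have hχdbar : ∀ v, ContDiff ℝ 1 (dbar v χ) := fun v =>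
    hχ.dbar (by norm_num [one_add_one_eq_two]) v
  set ψ : E → E → ℂ := fun v z => -(f z * dbar v χ z) with hψ
  have hdbar0 : ∀ z c, (χ =ᶠ[𝓝 z] fun _ => c) → ∀ v, dbar v χ =ᶠ[𝓝 z] fun _ => 0 :=
    fun z c h v => (dbar_eventuallyEq h v).trans (Eventually.of_forall fun w => dbar_const v c w)
  have hψ0 : ∀ z c, (χ =ᶠ[𝓝 z] fun _ => c) → ∀ v, ψ v =ᶠ[𝓝 z] fun _ => 0 := fun z c h v =>
    (hdbar0 z c h v).mono fun w hw => by simp [hψ, hw]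
  have hfd : ∀ z ∈ Ω \ K, DifferentiableAt ℂ f z := fun z hz =>
    hf.differentiableAt (hΩK.mem_nhds hz)
  have hψC : ∀ v, ContDiff ℝ 1 (ψ v) := fun v => contDiff_iff_contDiffAt.2 fun z => by
    rcases hcases z with hz | ⟨c, hc⟩
    · exact (((contDiffAt_one_of_holomorphic hΩK hf hz).restrict_scalars ℝ).mul
        (hχdbar v).contDiffAt).neg
    · exact contDiffAt_const.congr_of_eventuallyEq (hψ0 z c hc v)
  have hψsupp : ∀ v z, M ≤ ‖z‖ → ψ v z = 0 := fun v z hz =>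
    (hψ0 z 0 (hχ0 z fun h => hz.not_gt (by simpa using hχM h)) v).self_of_nhds
  have hψd : ∀ v w z, dbar w (ψ v) z = -(f z * dbar w (dbar v χ) z) := fun v w z => by
    rcases hcases z with hz | ⟨c, hc⟩
    · rw [hψ, dbar_neg, dbar_mul ((hfd z hz).restrictScalars ℝ)
        ((hχdbar v).differentiable one_ne_zero z), dbar_eq_zero (hfd z hz)]
      ring
    · rw [dbar_congr (hψ0 z c hc v), dbar_congr (hdbar0 z c hc v)]
      simp
  obtain ⟨u, hu, hudbar, hu0⟩ := exists_dbar_primitive hM hψC hψsupp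
    (fun v w z => by rw [hψd, hψd, dbar_comm hχ]) he
  have hχd : Differentiable ℝ χ := hχ.differentiable two_ne_zero
  have hhol : ∀ z, (∃ c, χ =ᶠ[𝓝 z] fun _ => c) → DifferentiableAt ℂ u z := fun z ⟨c, hc⟩ =>
    differentiableAt_complex_of_dbar_eq_zero (hu z) fun v => by
      rw [hudbar, (hψ0 z c hc v).self_of_nhds]
  set h : E → ℂ := fun z => -(χ z * f z) - u z with hh
  have hhΩK : ∀ z ∈ Ω \ K, DifferentiableAt ℂ h z := fun z hz => by
    have hfR := (hfd z hz).restrictScalars ℝ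
    have hm : DifferentiableAt ℝ (fun z => -(χ z * f z)) z := ((hχd z).mul hfR).neg
    refine differentiableAt_complex_of_dbar_eq_zero (hm.sub (hu z)) fun v => ?_
    rw [dbar_sub hm (hu z), dbar_neg, dbar_mul (hχd z) hfR, dbar_eq_zero (hfd z hz), hudbar]
    simp only [hψ]
    ring
  have hhK : DifferentiableOn ℂ h Kᶜ := fun z hz => by
    refine DifferentiableAt.differentiableWithinAt ?_
    by_cases hzΩ : z ∈ Ω
    · exact hhΩK z ⟨hzΩ, hz⟩
    · have hc := hχ0 z fun h => hzΩ (hχΩ h)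
      refine (hhol z ⟨0, hc⟩).neg.congr_of_eventuallyEq (hc.mono fun w hw => ?_)
      simp [hh, hw]
  -- The open set `‖l‖ M < ‖l z‖` is disjoint from the support of `χ`, and so are the complex lines
  -- in the direction `e` through its points.
  have hfar : ∀ z, ‖l‖ * M < ‖l z‖ → z ∉ tsupport χ := fun z hz hzχ => by
    have h1 : ‖z‖ < M := by simpa using hχM hzχ
    have h2 := l.le_opNorm z
    have h3 := mul_le_mul_of_nonneg_left h1.le (norm_nonneg l)
    linarith
  have hh0 : ∀ z, ‖l‖ * M < ‖l z‖ → h z = 0 := fun z hz => by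
    have : u z = 0 := hu0 z fun ζ => (hψ0 _ 0 (hχ0 _ (hfar _ (by
      rwa [map_sub, map_smul, hle, smul_zero, sub_zero]))) e).self_of_nhds
    simp only [hh, this, (hχ0 z (hfar z hz)).self_of_nhds]
    ring
  obtain ⟨a, ha⟩ : ∃ a : E, ‖l‖ * M < ‖l a‖ := by
    have hx : ‖x₀‖ ≠ 0 := norm_ne_zero_iff.2 hx₀
    refine ⟨((‖l‖ * M + 1 : ℝ) : ℂ) • (‖x₀‖⁻¹ : ℂ) • x₀, ?_⟩
    rw [map_smul, map_smul, hlx]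
    have : 0 ≤ ‖l‖ * M + 1 := by positivity
    simp only [smul_eq_mul, norm_mul, norm_real, norm_inv, norm_norm, Real.norm_of_nonneg this]
    simp [hx]
  have hhz : ∀ z ∈ Kᶜ, h z = 0 := by
    refine eqOn_zero_of_isPreconnected_of_eventuallyEq_zero hK.isClosed.isOpen_compl hconn hhK
      (fun haK => hfar a ha (hKχ haK)) ?_
    have : ∀ᶠ z in 𝓝 a, ‖l‖ * M < ‖l z‖ :=
      (l.continuous.norm.continuousAt).eventually_const_lt ha
    exact this.mono hh0
  refine ⟨fun z => (1 - χ z) * f z - u z, fun z hz => ?_, fun z hz => ?_⟩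
  · refine DifferentiableAt.differentiableWithinAt ?_
    by_cases hzK : z ∈ K
    · refine (hhol z ⟨1, hχK z hzK⟩).neg.congr_of_eventuallyEq ((hχK z hzK).mono fun w hw => ?_)
      simp [hw]
    · refine ((hfd z ⟨hz, hzK⟩).add (hhΩK z ⟨hz, hzK⟩)).congr_of_eventuallyEq
        (Eventually.of_forall fun w => ?_)
      simp only [hh, Pi.add_apply]
      ring
  · have := hhz z hz.2
    simp only [hh] at this
    linear_combination this

/-! ### The coincidence set -/

theorem closure_connectedComponentIn_inter_subset {X : Type*} [TopologicalSpace X] {F : Set X}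
    {x : X} (hx : x ∈ F) : closure (connectedComponentIn F x) ∩ F ⊆ connectedComponentIn F x :=
  (isPreconnected_connectedComponentIn.subset_closure
    (subset_inter subset_closure (connectedComponentIn_subset F x))
    inter_subset_left).subset_connectedComponentIn
    ⟨subset_closure (mem_connectedComponentIn hx), hx⟩ inter_subset_right

/-- The complement of a bounded set has a point with unbounded connected component: the component
contains a ray. -/
theorem exists_mem_unboundedComponent [Nontrivial E] {S : Set E} (hS : Bornology.IsBounded S) :
    ∃ z, z ∈ unboundedComponent S := by
  obtain ⟨R, hR⟩ := hS.subset_ball 0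
  obtain ⟨e, he⟩ := NormedSpace.exists_lt_norm ℝ E 0
  have he0 : ‖e‖ ≠ 0 := he.ne'
  set T : Set E := (fun t : ℝ => t • e) '' Ici (|R| / ‖e‖) with hT
  have hTpre : IsPreconnected T := isPreconnected_Ici.image _ (by fun_prop)
  have hTS : T ⊆ Sᶜ := by
    rintro _ ⟨t, ht, rfl⟩ hS'
    have h1 : ‖t • e‖ < R := by simpa using hR hS'
    have h2 : |R| ≤ t * ‖e‖ := (div_le_iff₀ he).1 ht
    rw [norm_smul, Real.norm_eq_abs] at h1
    have h3 := mul_le_mul_of_nonneg_right (le_abs_self t) he.le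
    linarith [le_abs_self R]
  have hmem : (|R| / ‖e‖) • e ∈ T := ⟨_, self_mem_Ici, rfl⟩
  refine ⟨(|R| / ‖e‖) • e, hTS hmem, fun hb => ?_⟩
  obtain ⟨C, hC⟩ := (hb.subset (hTpre.subset_connectedComponentIn hmem hTS)).exists_norm_le
  have := hC _ ⟨(|R| + |C| + 1) / ‖e‖,
    div_le_div_of_nonneg_right (by linarith [abs_nonneg C]) he.le, rfl⟩
  rw [norm_smul, norm_div, norm_norm, div_mul_cancel₀ _ he0, Real.norm_eq_abs,
    abs_of_nonneg (by positivity)] at this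
  linarith [le_abs_self C, abs_nonneg R]

/-- If `S` is a compact subset of a nonempty open set `ω`, an unbounded component of the complement
of `S` enters `ω`: otherwise it would be open and closed in the whole space. -/
theorem exists_isOpen_subset_unboundedComponent_inter [Nontrivial E] {S ω : Set E}
    (hS : IsCompact S) (hω : IsOpen ω) (hne : ω.Nonempty) (hSω : S ⊆ ω) :
    ∃ V, IsOpen V ∧ V ⊆ unboundedComponent S ∧ (V ∩ ω).Nonempty := by
  have : LocallyConnectedSpace E := by
    have : LocallyPathConnectedSpace E := LocallyConvexSpace.toLocallyPathConnectedSpace E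
    infer_instance
  obtain ⟨z, hz, hzb⟩ := exists_mem_unboundedComponent hS.isBounded
  have hVo : IsOpen (connectedComponentIn Sᶜ z) := hS.isClosed.isOpen_compl.connectedComponentIn
  refine ⟨connectedComponentIn Sᶜ z, hVo,
    fun w hw => ⟨connectedComponentIn_subset _ _ hw, ?_⟩, ?_⟩
  · rwa [← connectedComponentIn_eq hw]
  · by_contra hcon
    rw [not_nonempty_iff_eq_empty, ← disjoint_iff_inter_eq_empty] at hcon
    have hcl : IsClosed (connectedComponentIn Sᶜ z) := by
      refine isClosed_of_closure_subset fun w hw => ?_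
      refine closure_connectedComponentIn_inter_subset hz ⟨hw, fun hwS => ?_⟩
      exact disjoint_left.1 (hcon.closure_left hω) hw (hSω hwS)
    have huniv := IsClopen.eq_univ ⟨hcl, hVo⟩ ⟨z, mem_connectedComponentIn hz⟩
    obtain ⟨x, hx⟩ := hne
    exact disjoint_left.1 hcon (huniv ▸ mem_univ x) hx

theorem coincidenceSet_subset {E : Type*} [NormedAddCommGroup E] (Ω K : Set E) :
    coincidenceSet Ω K ⊆ Ω \ K := by
  rintro z ⟨x, -, hz, hzu⟩
  exact ⟨connectedComponentIn_subset _ _ hz, fun hzK => hzu.1 ⟨hzK, hz⟩⟩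

/-- A holomorphic function is determined by its values on the coincidence set, because that set has
interior points in each connected component. -/
theorem eqOn_zero_of_eqOn_zero_coincidenceSet [Nontrivial E] {Ω K : Set E} (hΩ : IsOpen Ω)
    (hK : IsCompact K) (hKΩ : K ⊆ Ω) {f : E → ℂ} (hf : DifferentiableOn ℂ f Ω)
    (h0 : ∀ z ∈ coincidenceSet Ω K, f z = 0) : ∀ z ∈ Ω, f z = 0 := by
  intro x hx
  have hωo : IsOpen (connectedComponentIn Ω x) := by
    have : LocallyPathConnectedSpace E := LocallyConvexSpace.toLocallyPathConnectedSpace E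
    exact hΩ.connectedComponentIn
  have hxω := mem_connectedComponentIn hx
  have hS : IsCompact (K ∩ connectedComponentIn Ω x) := by
    have : K ∩ connectedComponentIn Ω x = K ∩ closure (connectedComponentIn Ω x) :=
      (inter_subset_inter_right _ subset_closure).antisymm fun z hz =>
        ⟨hz.1, closure_connectedComponentIn_inter_subset hx ⟨hz.2, hKΩ hz.1⟩⟩
    rw [this]
    exact hK.inter_right isClosed_closure
  obtain ⟨V, hV, hVu, a, haV, haω⟩ := exists_isOpen_subset_unboundedComponent_inter hS hωo
    ⟨x, hxω⟩ inter_subset_right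
  refine eqOn_zero_of_isPreconnected_of_eventuallyEq_zero hωo isPreconnected_connectedComponentIn
    (hf.mono (connectedComponentIn_subset _ _)) haω ?_ x hxω
  filter_upwards [(hV.inter hωo).mem_nhds ⟨haV, haω⟩] with z hz
  exact h0 z ⟨x, hx, hz.2, hVu hz.1⟩

/-! ### The restriction morphism -/

theorem Holo.ext_of_coincidenceSet [Nontrivial E] {Ω K : Set E} (hΩ : IsOpen Ω)
    (hK : IsCompact K) (hKΩ : K ⊆ Ω) {F G : Holo Ω}
    (h : ∀ z : ↥(Ω \ K), z.1 ∈ coincidenceSet Ω K → F.1 ⟨z.1, z.2.1⟩ = G.1 ⟨z.1, z.2.1⟩) :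
    F = G := by
  obtain ⟨F', hF', hF⟩ := F.2
  obtain ⟨G', hG', hG⟩ := G.2
  have := eqOn_zero_of_eqOn_zero_coincidenceSet hΩ hK hKΩ (hF'.sub hG') fun z hz => by
    have hz' := coincidenceSet_subset Ω K hz
    have := h ⟨z, hz'⟩ hz
    rw [← hF, ← hG] at this
    simpa [sub_eq_zero] using this
  refine Subtype.ext (funext fun z => ?_)
  rw [← hF, ← hG]
  simpa [sub_eq_zero] using this z z.2

theorem Holo.ext_of_diff [Nontrivial E] {Ω K : Set E} (hΩ : IsOpen Ω)
    (hK : IsCompact K) (hKΩ : K ⊆ Ω) {F G : Holo Ω}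
    (h : ∀ z : ↥(Ω \ K), F.1 ⟨z.1, z.2.1⟩ = G.1 ⟨z.1, z.2.1⟩) : F = G :=
  Holo.ext_of_coincidenceSet hΩ hK hKΩ fun z _ => h z

theorem holoRestrict_injective [Nontrivial E] {Ω K : Set E} (hΩ : IsOpen Ω)
    (hK : IsCompact K) (hKΩ : K ⊆ Ω) : Function.Injective (holoRestrict Ω K) :=
  fun _ _ h => Holo.ext_of_diff hΩ hK hKΩ fun z => congrFun (congrArg Subtype.val h) z

theorem holoRestrict_eq_iff_extends {Ω K : Set E} {F : Holo Ω} {f : Holo (Ω \ K)} :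
    holoRestrict Ω K F = f ↔ Extends Ω K F.1 f.1 :=
  Subtype.ext_iff.trans funext_iff

theorem holoRestrict_surjective [FiniteDimensional ℂ E] (hE : 1 < Module.finrank ℂ E) {Ω K : Set E}
    (hΩ : IsOpen Ω) (hK : IsCompact K) (hKΩ : K ⊆ Ω) (hconn : IsPreconnected Kᶜ) :
    Function.Surjective (holoRestrict Ω K) := fun f => by
  obtain ⟨f', hf', hf⟩ := f.2
  obtain ⟨F, hF, hFf⟩ := exists_holomorphic_extension hE hΩ hK hKΩ hconn hf'
  refine ⟨⟨fun z => F z, F, hF, fun _ => rfl⟩, holoRestrict_eq_iff_extends.2 fun z => ?_⟩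
  rw [← hf]
  exact hFf z z.2

theorem IsLocallyConstant.mem_holo {U : Set E} (hU : IsOpen U) {g : U → ℂ}
    (hg : IsLocallyConstant g) : g ∈ Holo U := by
  refine ⟨Function.extend Subtype.val g 0, fun z hz => ?_, fun z =>
    Subtype.val_injective.extend_apply g 0 z⟩
  refine DifferentiableAt.differentiableWithinAt ?_
  refine (differentiableAt_const (g ⟨z, hz⟩)).congr_of_eventuallyEq ?_
  have h := hg.eventually_eq ⟨z, hz⟩
  have hmap := hU.isOpenEmbedding_subtypeVal.map_nhds_eq ⟨z, hz⟩
  rw [EventuallyEq, ← hmap, eventually_map]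
  filter_upwards [h] with w hw
  rw [Subtype.val_injective.extend_apply, hw]

/-- The connectedness of the complement of `K` follows from the extension of locally constant
functions. A separation of `Kᶜ` gives a function on `Ω \ K` with values in `{0, 1}`; its extension
to `Ω` also has values in `{0, 1}`, and glues with the separation of `Kᶜ` to one of the whole
space. -/
theorem isPreconnected_compl_of_locallyConstant_extends [Nontrivial E] {Ω K : Set E}
    (hΩ : IsOpen Ω) (hK : IsCompact K) (hKΩ : K ⊆ Ω)
    (h : ∀ g : ↥(Ω \ K) → ℂ, IsLocallyConstant g → ∃ F : Holo Ω, Extends Ω K F.1 g) :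
    IsPreconnected Kᶜ := by
  classical
  have hKo : IsOpen Kᶜ := hK.isClosed.isOpen_compl
  rw [isPreconnected_iff_subset_of_disjoint]
  intro u v hu hv huv hdisj
  have hnot : ∀ z ∈ Kᶜ, z ∈ u → z ∉ v := fun z hz hzu hzv => by
    have : z ∈ Kᶜ ∩ (u ∩ v) := ⟨hz, hzu, hzv⟩
    rwa [hdisj] at this
  set g : ↥(Ω \ K) → ℂ := fun z => if z.1 ∈ u then 1 else 0 with hg
  have hgl : IsLocallyConstant g := by
    rw [IsLocallyConstant.iff_eventually_eq]
    intro z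
    rcases huv z.2.2 with hz | hz
    · filter_upwards [(hu.preimage continuous_subtype_val).mem_nhds hz] with w hw
      rw [hg]
      simp only [mem_preimage] at hw
      simp [hw, hz]
    · filter_upwards [(hv.preimage continuous_subtype_val).mem_nhds hz] with w hw
      have h1 : w.1 ∉ u := fun h => hnot _ w.2.2 h hw
      have h2 : z.1 ∉ u := fun h => hnot _ z.2.2 h hz
      simp [hg, h1, h2]
  obtain ⟨F, hF⟩ := h g hgl
  have hidem : F * F = F := Holo.ext_of_diff hΩ hK hKΩ fun z => by
    change F.1 _ * F.1 _ = F.1 _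
    rw [hF z]
    by_cases hz : z.1 ∈ u <;> simp [hg, hz]
  obtain ⟨F', hF', hFF'⟩ := F.2
  have h01 : ∀ z ∈ Ω, F' z = 0 ∨ F' z = 1 := fun z hz => by
    have := congrFun (congrArg Subtype.val hidem) ⟨z, hz⟩
    change F.1 _ * F.1 _ = F.1 _ at this
    rw [← hFF'] at this
    have : F' z * (F' z - 1) = 0 := by linear_combination this
    rcases mul_eq_zero.1 this with h | h
    · exact Or.inl h
    · exact Or.inr (sub_eq_zero.1 h)
  have hval : ∀ z ∈ Ω, z ∈ Kᶜ → F' z = if z ∈ u then 1 else 0 := fun z hz hzK => by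
    have := hF ⟨z, hz, hzK⟩
    rwa [← hFF'] at this
  have hA : IsOpen (Ω ∩ F' ⁻¹' {0}ᶜ ∪ Kᶜ ∩ u) :=
    (hF'.continuousOn.isOpen_inter_preimage hΩ isOpen_compl_singleton).union (hKo.inter hu)
  have hB : IsOpen (Ω ∩ F' ⁻¹' {1}ᶜ ∪ Kᶜ ∩ v) :=
    (hF'.continuousOn.isOpen_inter_preimage hΩ isOpen_compl_singleton).union (hKo.inter hv)
  have hAK : ∀ z ∈ Kᶜ, z ∈ Ω ∩ F' ⁻¹' {0}ᶜ ∪ Kᶜ ∩ u → z ∈ u := by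
    rintro z hz (⟨hzΩ, hz0⟩ | ⟨-, hzu⟩)
    · by_contra hzu
      exact hz0 (by simpa [hzu] using hval z hzΩ hz)
    · exact hzu
  have hBK : ∀ z ∈ Kᶜ, z ∈ Ω ∩ F' ⁻¹' {1}ᶜ ∪ Kᶜ ∩ v → z ∈ v := by
    rintro z hz (⟨hzΩ, hz0⟩ | ⟨-, hzv⟩)
    · refine (huv hz).resolve_left fun hzu => ?_
      exact hz0 (by simpa [hzu] using hval z hzΩ hz)
    · exact hzv
  have := isPreconnected_iff_subset_of_disjoint.1 (isPreconnected_univ (α := E)) _ _ hA hB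
    (fun z _ => by
      by_cases hzK : z ∈ K
      · rcases h01 z (hKΩ hzK) with h | h
        · exact Or.inr (Or.inl ⟨hKΩ hzK, by simp [h]⟩)
        · exact Or.inl (Or.inl ⟨hKΩ hzK, by simp [h]⟩)
      · exact (huv hzK).imp (fun h => Or.inr ⟨hzK, h⟩) fun h => Or.inr ⟨hzK, h⟩)
    (by
      refine eq_empty_of_forall_notMem fun z hz => ?_
      by_cases hzK : z ∈ K
      · have h0 : F' z ≠ 0 := (hz.2.1.resolve_right fun h => h.1 hzK).2
        have h1 : F' z ≠ 1 := (hz.2.2.resolve_right fun h => h.1 hzK).2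
        exact (h01 z (hKΩ hzK)).elim h0 h1
      · exact hnot z hzK (hAK z hzK hz.2.1) (hBK z hzK hz.2.2))
  exact this.imp (fun h z hz => hAK z hz (h (mem_univ z))) fun h z hz => hBK z hz (h (mem_univ z))

/-- If every holomorphic function on `Ω \ K` extends, restriction preserves ranges: a value `c` of
`F` that is not taken off `K` would make `1 / (F - c)` extend to an inverse of `F - c`. -/
theorem range_eq_range_holoRestrict [Nontrivial E] {Ω K : Set E} (hΩ : IsOpen Ω)
    (hK : IsCompact K) (hKΩ : K ⊆ Ω) (hsurj : Function.Surjective (holoRestrict Ω K))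
    (F : Holo Ω) : range F.1 = range (holoRestrict Ω K F).1 := by
  refine Subset.antisymm ?_ (range_subset_iff.2 fun z => ⟨⟨z.1, z.2.1⟩, rfl⟩)
  rintro _ ⟨z₀, rfl⟩
  by_contra hc
  obtain ⟨F', hF', hFF'⟩ := F.2
  have hne : ∀ z ∈ Ω \ K, F' z - F.1 z₀ ≠ 0 := fun z hz h =>
    hc ⟨⟨z, hz⟩, ((hFF' ⟨z, hz.1⟩).symm.trans (sub_eq_zero.1 h))⟩
  obtain ⟨G, hG⟩ := hsurj ⟨fun z => (F' z - F.1 z₀)⁻¹, fun z => (F' z - F.1 z₀)⁻¹,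
    ((hF'.mono sdiff_subset).sub_const _).inv hne, fun _ => rfl⟩
  have hG' := holoRestrict_eq_iff_extends.1 hG
  have hprod : (F - algebraMap ℂ (Holo Ω) (F.1 z₀)) * G = 1 :=
    Holo.ext_of_diff hΩ hK hKΩ fun z => by
    change (F.1 ⟨z.1, z.2.1⟩ - F.1 z₀) * G.1 ⟨z.1, z.2.1⟩ = 1
    rw [hG' z, ← hFF']
    exact mul_inv_cancel₀ (hne z z.2)
  have := congrFun (congrArg Subtype.val hprod) z₀
  change (F.1 z₀ - F.1 z₀) * G.1 z₀ = 1 at this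
  simp at this

end HolomorphicExtension

theorem theorem2p6 (n : ℕ) (hn : 2 ≤ n) (Ω K : Set (EuclideanSpace ℂ (Fin n)))
    (hΩ : IsOpen Ω) (hK : IsCompact K) (hKΩ : K ⊆ Ω) :
    List.TFAE [
      -- (i) every holomorphic function has a holomorphic extension
      ∀ f : Holo (Ω \ K), ∃ F : Holo Ω, Extends Ω K F.1 f.1,
      -- (i), with uniqueness
      ∀ f : Holo (Ω \ K), ∃! F : Holo Ω, Extends Ω K F.1 f.1,
      -- (i') every locally constant function has a holomorphic extension
      ∀ g : ↥(Ω \ K) → ℂ, IsLocallyConstant g → ∃ F : Holo Ω, Extends Ω K F.1 g,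
      -- (ii) the restriction is an isomorphism of algebras
      ∃ e : Holo Ω ≃ₐ[ℂ] Holo (Ω \ K), ∀ f : Holo Ω, e f = holoRestrict Ω K f,
      -- (iii)
      IsConnected Kᶜ] ∧
    (IsConnected Kᶜ →
      -- the restriction preserves ranges
      (∀ f : Holo Ω, Set.range f.1 = f.1 '' {z : Ω | z.1 ∉ K}) ∧
      -- its inverse is the Hartogs companion operator, which preserves ranges as well
      ∃ H : Holo (Ω \ K) ≃ₐ[ℂ] Holo Ω,
        (∀ (f : Holo (Ω \ K)) (F : Holo Ω), IsHartogsCompanion Ω K f F ↔ F = H f) ∧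
        (∀ f : Holo Ω, H.symm f = holoRestrict Ω K f) ∧
        ∀ f : Holo (Ω \ K), Set.range (H f).1 = Set.range f.1) := by
  have hE : 1 < Module.finrank ℂ (EuclideanSpace ℂ (Fin n)) := by
    rw [finrank_euclideanSpace_fin]; omega
  have : Nontrivial (EuclideanSpace ℂ (Fin n)) :=
    Module.nontrivial_of_finrank_pos (R := ℂ) (by omega)
  have hinj := holoRestrict_injective hΩ hK hKΩ
  have hsurj_iff : (∀ f : Holo (Ω \ K), ∃ F : Holo Ω, Extends Ω K F.1 f.1) ↔
      Function.Surjective (holoRestrict Ω K) :=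
    forall_congr' fun f => exists_congr fun F => holoRestrict_eq_iff_extends.symm
  refine ⟨?_, fun hconn => ?_⟩
  · tfae_have 1 → 2 := fun h f => by
      obtain ⟨F, hF⟩ := h f
      exact ⟨F, hF, fun G hG => hinj ((holoRestrict_eq_iff_extends.2 hG).trans
        (holoRestrict_eq_iff_extends.2 hF).symm)⟩
    tfae_have 2 → 1 := fun h f => (h f).exists
    tfae_have 1 → 3 := fun h g hg => h ⟨g, hg.mem_holo (hΩ.sdiff hK.isClosed)⟩
    tfae_have 3 → 5 := fun h => by
      obtain ⟨z, hz⟩ := exists_mem_unboundedComponent hK.isBounded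
      exact ⟨⟨z, hz.1⟩, isPreconnected_compl_of_locallyConstant_extends hΩ hK hKΩ h⟩
    tfae_have 5 → 1 := fun h =>
      hsurj_iff.2 (holoRestrict_surjective hE hΩ hK hKΩ h.isPreconnected)
    tfae_have 1 → 4 := fun h =>
      ⟨AlgEquiv.ofBijective (holoRestrict Ω K) ⟨hinj, hsurj_iff.1 h⟩, fun _ => rfl⟩
    tfae_have 4 → 1 := fun ⟨e, he⟩ => hsurj_iff.2 fun f => by
      obtain ⟨F, hF⟩ := e.surjective f
      exact ⟨F, (he F).symm.trans hF⟩
    tfae_finish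
  · have hsurj := holoRestrict_surjective hE hΩ hK hKΩ hconn.isPreconnected
    have hrange := range_eq_range_holoRestrict hΩ hK hKΩ hsurj
    let e := AlgEquiv.ofBijective (holoRestrict Ω K) ⟨hinj, hsurj⟩
    have he : ∀ f, holoRestrict Ω K (e.symm f) = f := e.apply_symm_apply
    refine ⟨fun F => ?_, e.symm, fun f F => ⟨fun h => ?_, ?_⟩, fun F => rfl, fun f => ?_⟩
    · rw [hrange F]
      ext c
      exact ⟨fun ⟨z, hz⟩ => ⟨⟨z.1, z.2.1⟩, z.2.2, hz⟩, fun ⟨z, hzK, hz⟩ => ⟨⟨z.1, z.2, hzK⟩, hz⟩⟩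
    · exact Holo.ext_of_coincidenceSet hΩ hK hKΩ fun z hz =>
        (h z hz).trans (holoRestrict_eq_iff_extends.1 (he f) z).symm
    · rintro rfl z -
      exact holoRestrict_eq_iff_extends.1 (he f) z
    · rw [hrange, he]
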